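/- For a relation $R$ on a set $X$ and $a,b\subseteq X$ write $[R]a=\{x\mid \forall y\,(xRy\Rightarrow y\in a)\}$ and $a\Rightarrow_R b=\{x\mid \forall y\,(xRy \text{ and } y\in a \text{ imply } y\in b)\}$. A *general $⥽$-frame* is a tuple $\mathfrak G=(X,\preceq,\sqsubset,P)$ where $(X,\preceq)$ is a poset, $\sqsubset$ is a binary relation on $X$ such that $x\preceq y\sqsubset z$ implies $x\sqsubset z$, and $P$ is a collection of $\preceq$-upsets of $X$ containing $X$ and $\emptyset$ and closed under $\cap$, $\cup$, $\Rightarrow_{\preceq}$ and $\Rightarrow_{\sqsubset}$. It is *descriptive* if: (compact) for all $A\subseteq P$ and $B\subseteq\{X\setminus a\mid a\in P\}$, if $A\cup B$ has the finite intersection property then $\bigcap(A\cup B)\neq\emptyset$; ($\preceq$-refined) $x\not\preceq y$ implies that there is $a\in P$ with $x\in a$, $y\notin a$; ($\sqsubset$-refined) $x\not\sqsubset y$ implies that there are $a,b\in P$ with $x\in a\Rightarrow_{\sqsubset}b$, $y\in a$, $y\notin b$. A *general S4K-frame* is a tuple $\mathfrak F=(X,R_{\mathsf i},R_{\mathsf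 m},P)$ where $R_{\mathsf i}$ is a preorder on $X$, $R_{\mathsf m}$ is a binary relation on $X$, and $P$ is a Boolean subalgebra of the powerset of $X$ closed under $[R_{\mathsf i}]$ and $[R_{\mathsf m}]$. It is *descriptive* if it is differentiated ($x=y$ iff $x$ and $y$ belong to the same members of $P$), tight (for each $R\in\{R_{\mathsf i},R_{\mathsf m}\}$: $xRy$ iff for all $a\in P$, $x\in[R]a$ implies $y\in a$) and compact (every $A\subseteq P$ with the finite intersection property has $\bigcap A\neq\emptyset$). For a general S4K-frame $\mathfrak F=(X,R_{\mathsf i},R_{\mathsf m},P)$ define the general $⥽$-frame $\hat\rho\mathfrak F=([X],[R_{\mathsf i}],[R_{\mathsf m}^*],\hat\rho P)$ as follows. Let $x\,R_{\mathsf m}^*\,z$ iff $x R_{\mathsf i} y$ and $y R_{\mathsf m} z$ for some $y$. Let $[X]$ be the set of classes $[x]$ (clusters) of the equivalence relation $x\sim y$ iff $xR_{\mathsf i}y$ and $yR_{\mathsf i}x$; let $[x][R_{\mathsf i}][y]$ iff $xR_{\mathsf i}y$, and $[x][R_{\mathsf m}^*][y]$ iff $xR_{\mathsf m}^*y'$ for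 some $y'\sim y$. Let $\hat\rho P$ consist of the sets $[[R_{\mathsf i}]]\,c$ with $c\subseteq[X]$ such that $\bigcup c\in P$. For a general $⥽$-frame $\mathfrak G=(X,\preceq,\sqsubset,P)$ define the general S4K-frame $\hat\sigma\mathfrak G=(X,\preceq,\sqsubset,\hat\sigma P)$, where $\hat\sigma P$ is the Boolean subalgebra of the powerset of $X$ generated by $P$. **Proposition.** Both $\hat\rho$ and $\hat\sigma$ preserve descriptiveness: if $\mathfrak F$ is a descriptive general S4K-frame, then $\hat\rho\mathfrak F$ is a descriptive general $⥽$-frame; and if $\mathfrak G$ is a descriptive general $⥽$-frame, then $\hat\sigma\mathfrak G$ is a descriptive general S4K-frame. -/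

import Mathlib

/-! ### Operations on subsets induced by a relation -/

/-- `a` is upward closed under the relation `R`. -/
def RelUpset {X : Type*} (R : X → X → Prop) (a : Set X) : Prop :=
  ∀ x y, x ∈ a → R x y → y ∈ a

/-- The box operator `[R] a = {x | x R y implies y ∈ a}`. -/
def relBox {X : Type*} (R : X → X → Prop) (a : Set X) : Set X :=
  {x | ∀ y, R x y → y ∈ a}

/-- The binary implication induced by `R`:
`{x | x R y and y ∈ a imply y ∈ b}`. For the partial order of a frame this is the Heyting
implication of upsets, for its second relation it is the strict implication. -/
def relImp {X : Type*} (R : X → X → Prop) (a b : Set X) : Set X :=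
  {x | ∀ y, R x y → y ∈ a → y ∈ b}

/-- The finite intersection property (the empty intersection being the whole set). -/
def HasFIP {X : Type*} (S : Set (Set X)) : Prop :=
  ∀ T : Set (Set X), T ⊆ S → T.Finite → (⋂₀ T).Nonempty

/-! ### Strict implication frames -/

/-- A strict implication frame: a poset with a second relation `sq` such that
`x ≼ y ⊏ z` implies `x ⊏ z`. -/
structure StrictFrame (X : Type*) where
  le : X → X → Prop
  sq : X → X → Prop
  isPartialOrder : IsPartialOrder X le
  sq_of_le_of_sq : ∀ x y z, le x y → sq y z → sq x z

/-- A general strict implication frame: a strict implication frame with a collection `adm` of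
admissible upsets containing the whole set and the empty set, closed under intersection, union,
Heyting implication and strict implication. -/
structure GenStrictFrame (X : Type*) extends StrictFrame X where
  adm : Set (Set X)
  upset_of_adm : ∀ a ∈ adm, RelUpset le a
  univ_adm : Set.univ ∈ adm
  empty_adm : ∅ ∈ adm
  inter_adm : ∀ a ∈ adm, ∀ b ∈ adm, a ∩ b ∈ adm
  union_adm : ∀ a ∈ adm, ∀ b ∈ adm, a ∪ b ∈ adm
  imp_adm : ∀ a ∈ adm, ∀ b ∈ adm, relImp le a b ∈ adm
  simp_adm : ∀ a ∈ adm, ∀ b ∈ adm, relImp sq a b ∈ adm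

namespace GenStrictFrame

variable {X : Type*} (G : GenStrictFrame X)

def Compact : Prop :=
  ∀ A B : Set (Set X), A ⊆ G.adm → B ⊆ {c | ∃ a ∈ G.adm, c = aᶜ} →
    HasFIP (A ∪ B) → (⋂₀ (A ∪ B)).Nonempty

def LeRefined : Prop :=
  ∀ x y, ¬ G.le x y → ∃ a ∈ G.adm, x ∈ a ∧ y ∉ a

def SqRefined : Prop :=
  ∀ x y, ¬ G.sq x y → ∃ a ∈ G.adm, ∃ b ∈ G.adm, x ∈ relImp G.sq a b ∧ y ∈ a ∧ y ∉ b

structure Descriptive : Prop where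
  compact : G.Compact
  leRefined : G.LeRefined
  sqRefined : G.SqRefined

end GenStrictFrame

/-! ### S4K-frames -/

/-- An S4K-frame: a set with a preorder `Ri` and a binary relation `Rm`. -/
structure S4KFrame (X : Type*) where
  Ri : X → X → Prop
  Rm : X → X → Prop
  isPreorder : IsPreorder X Ri

attribute [instance] S4KFrame.isPreorder

/-- The condition `Ri ∘ Rm ⊆ Rm` singling out the S4BHL-frames (where `∘` is relational
composition in diagrammatic order). -/
def S4KFrame.IsBHL {X : Type*} (F : S4KFrame X) : Prop :=
  ∀ x y z, F.Ri x y → F.Rm y z → F.Rm x z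

/-- A general S4K-frame: an S4K-frame with a Boolean subalgebra `adm` of the powerset that is
closed under both box operators. -/
structure GenS4KFrame (X : Type*) extends S4KFrame X where
  adm : BooleanSubalgebra (Set X)
  boxI_adm : ∀ a ∈ adm, relBox Ri a ∈ adm
  boxM_adm : ∀ a ∈ adm, relBox Rm a ∈ adm

namespace GenS4KFrame

variable {X : Type*} (F : GenS4KFrame X)

def Differentiated : Prop :=
  ∀ x y, x = y ↔ ∀ a ∈ F.adm, (x ∈ a ↔ y ∈ a)

/-- Tightness of a relation `R` with respect to the admissible sets. -/
def TightFor (R : X → X → Prop) : Prop :=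
  ∀ x y, R x y ↔ ∀ a ∈ F.adm, x ∈ relBox R a → y ∈ a

def Compact : Prop :=
  ∀ A : Set (Set X), A ⊆ (F.adm : Set (Set X)) → HasFIP A → (⋂₀ A).Nonempty

structure Descriptive : Prop where
  differentiated : F.Differentiated
  tightI : F.TightFor F.Ri
  tightM : F.TightFor F.Rm
  compact : F.Compact

end GenS4KFrame

/-! ### From general strict implication frames to general S4K-frames -/

theorem relBox_compl_closure_mem {X : Type*} {P : Set (Set X)} (R : X → X → Prop)
    (huniv : Set.univ ∈ P) (hempty : ∅ ∈ P)
    (hinter : ∀ a ∈ P, ∀ b ∈ P, a ∩ b ∈ P) (hunion : ∀ a ∈ P, ∀ b ∈ P, a ∪ b ∈ P)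
    (himp : ∀ a ∈ P, ∀ b ∈ P, relImp R a b ∈ P)
    (c : Set X) (hc : c ∈ BooleanSubalgebra.closure P) : relBox R cᶜ ∈ P := by
  have hP : IsSublattice P := ⟨fun a ha b hb => hunion a ha b hb,
    fun a ha b hb => hinter a ha b hb⟩
  refine BooleanSubalgebra.closure_sdiff_sup_induction (p := fun c _ => relBox R cᶜ ∈ P)
    hP hempty huniv ?_ ?_ c hc
  · intro x hx y hy
    convert himp x hx y hy using 1
    ext w
    simp only [relBox, relImp, Set.mem_ofPred_eq, Set.mem_compl_iff, Set.mem_sdiff, not_and, not_not]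
  · intro x _ y _ h1 h2
    convert hinter _ h1 _ h2 using 1
    ext w
    simp only [relBox, Set.mem_ofPred_eq, Set.mem_compl_iff, Set.sup_eq_union, Set.mem_union,
      Set.mem_inter_iff, not_or, forall_and]

theorem GenStrictFrame.relBox_closure_mem {X : Type*} (G : GenStrictFrame X) {R : X → X → Prop}
    (himp : ∀ a ∈ G.adm, ∀ b ∈ G.adm, relImp R a b ∈ G.adm) (a : Set X)
    (ha : a ∈ BooleanSubalgebra.closure G.adm) :
    relBox R a ∈ BooleanSubalgebra.closure G.adm := by
  have h := relBox_compl_closure_mem R G.univ_adm G.empty_adm G.inter_adm G.union_adm himp aᶜ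
    (BooleanSubalgebra.compl_mem ha)
  rw [compl_compl] at h
  exact BooleanSubalgebra.subset_closure h

/-- The translation `σ̂`: the same set and relations, with the Boolean closure of the admissible
upsets in the powerset as admissible sets. -/
def GenStrictFrame.sigmaHat {X : Type*} (G : GenStrictFrame X) : GenS4KFrame X where
  Ri := G.le
  Rm := G.sq
  isPreorder := G.isPartialOrder.toIsPreorder
  adm := BooleanSubalgebra.closure G.adm
  boxI_adm := G.relBox_closure_mem G.imp_adm
  boxM_adm := G.relBox_closure_mem G.simp_adm

/-! ### From general S4K-frames to general strict implication frames -/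

namespace GenS4KFrame

variable {X : Type*} (F : GenS4KFrame X)

/-- The frame `F*`, in which `Rm` is replaced by `Rm* = Ri ∘ Rm`, that is,
`x Rm* z` iff `x Ri y` and `y Rm z` for some `y`. -/
def star : GenS4KFrame X where
  Ri := F.Ri
  Rm := Relation.Comp F.Ri F.Rm
  isPreorder := F.isPreorder
  adm := F.adm
  boxI_adm := F.boxI_adm
  boxM_adm := fun a ha => by
    convert F.boxI_adm _ (F.boxM_adm a ha) using 1
    ext x
    exact ⟨fun h y hy z hz => h z ⟨y, hy, hz⟩, fun h z ⟨y, hy, hz⟩ => h y hy z hz⟩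

theorem star_isBHL : F.star.IsBHL :=
  fun _ _ _ hxy ⟨w, hyw, hwz⟩ => ⟨w, F.isPreorder.trans _ _ _ hxy hyw, hwz⟩

/-- The set of `Ri`-clusters: the quotient of `X` by `x ∼ y` iff `x Ri y` and `y Ri x`. -/
def Cluster : Type _ := Antisymmetrization X F.Ri

/-- The cluster of a point. -/
def toCluster : X → F.Cluster := toAntisymmetrization F.Ri

theorem toCluster_eq_iff {x y : X} : F.toCluster x = F.toCluster y ↔ F.Ri x y ∧ F.Ri y x :=
  Quotient.eq (r := AntisymmRel.setoid X F.Ri)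

theorem toCluster_surjective : Function.Surjective F.toCluster :=
  fun A => Quotient.exists_rep (s := AntisymmRel.setoid X F.Ri) A

/-- The relation on clusters induced by `Ri`. -/
def clusterRi (A B : F.Cluster) : Prop :=
  ∃ x y, F.toCluster x = A ∧ F.toCluster y = B ∧ F.Ri x y

/-- The relation on clusters induced by `Rm`. For S4BHL-frames the choice of the representative
of the first cluster is irrelevant, see `clusterRm_iff`. -/
def clusterRm (A B : F.Cluster) : Prop :=
  ∃ x y, F.toCluster x = A ∧ F.toCluster y = B ∧ F.Rm x y

theorem clusterRi_iff {x y : X} :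
    F.clusterRi (F.toCluster x) (F.toCluster y) ↔ F.Ri x y := by
  constructor
  · rintro ⟨x', y', hx, hy, h⟩
    rw [toCluster_eq_iff] at hx hy
    exact F.isPreorder.trans _ _ _ hx.2 (F.isPreorder.trans _ _ _ h hy.1)
  · exact fun h => ⟨x, y, rfl, rfl, h⟩

theorem clusterRm_iff (hF : F.IsBHL) {x y : X} :
    F.clusterRm (F.toCluster x) (F.toCluster y) ↔
      ∃ y', F.toCluster y' = F.toCluster y ∧ F.Rm x y' := by
  constructor
  · rintro ⟨x', y', hx, hy, h⟩
    rw [toCluster_eq_iff] at hx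
    exact ⟨y', hy, hF _ _ _ hx.2 h⟩
  · rintro ⟨y', hy, h⟩
    exact ⟨x, y', rfl, hy, h⟩

/-- The sets `A` of clusters whose union `⋃ A = {x | the cluster of x is in A}` is admissible. -/
def clusterAdm : Set (Set F.Cluster) :=
  {A | F.toCluster ⁻¹' A ∈ F.adm}

/-- The admissible sets of `ρ̂ F`: the boxes, with respect to the order on clusters, of the
elements of `clusterAdm`. -/
def rhoAdm : Set (Set F.Cluster) :=
  {B | ∃ A ∈ F.clusterAdm, B = relBox F.clusterRi A}

theorem mem_rhoAdm_iff {B : Set F.Cluster} :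
    B ∈ F.rhoAdm ↔ RelUpset F.clusterRi B ∧ F.toCluster ⁻¹' B ∈ F.adm := by
  constructor
  · rintro ⟨A, hA, rfl⟩
    constructor
    · intro S T hS hST U hU
      obtain ⟨x, rfl⟩ := F.toCluster_surjective S
      obtain ⟨y, rfl⟩ := F.toCluster_surjective T
      obtain ⟨z, rfl⟩ := F.toCluster_surjective U
      rw [clusterRi_iff] at hST hU
      exact hS _ (F.clusterRi_iff.2 (F.isPreorder.trans _ _ _ hST hU))
    · convert F.boxI_adm _ hA using 1
      ext x
      constructor
      · exact fun h y hy => h _ (F.clusterRi_iff.2 hy)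
      · intro h S hS
        obtain ⟨y, rfl⟩ := F.toCluster_surjective S
        exact h y (F.clusterRi_iff.1 hS)
  · rintro ⟨hup, hB⟩
    refine ⟨B, hB, Set.ext fun S => ⟨fun h T hT => hup S T h hT, fun h => h S ?_⟩⟩
    obtain ⟨x, rfl⟩ := F.toCluster_surjective S
    exact F.clusterRi_iff.2 (F.isPreorder.refl x)

theorem isPartialOrder_clusterRi : IsPartialOrder F.Cluster F.clusterRi where
  refl S := by
    obtain ⟨x, rfl⟩ := F.toCluster_surjective S
    exact F.clusterRi_iff.2 (F.isPreorder.refl x)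
  trans S T U hST hTU := by
    obtain ⟨x, rfl⟩ := F.toCluster_surjective S
    obtain ⟨y, rfl⟩ := F.toCluster_surjective T
    obtain ⟨z, rfl⟩ := F.toCluster_surjective U
    rw [clusterRi_iff] at *
    exact F.isPreorder.trans _ _ _ hST hTU
  antisymm S T hST hTS := by
    obtain ⟨x, rfl⟩ := F.toCluster_surjective S
    obtain ⟨y, rfl⟩ := F.toCluster_surjective T
    rw [clusterRi_iff] at *
    exact F.toCluster_eq_iff.2 ⟨hST, hTS⟩

theorem preimage_relImp_clusterRi (A B : Set F.Cluster) :
    F.toCluster ⁻¹' relImp F.clusterRi A B =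
      relBox F.Ri ((F.toCluster ⁻¹' A)ᶜ ∪ F.toCluster ⁻¹' B) := by
  ext x
  constructor
  · intro h y hy
    by_cases hA : F.toCluster y ∈ A
    · exact Or.inr (h _ (F.clusterRi_iff.2 hy) hA)
    · exact Or.inl hA
  · intro h S hS hA
    obtain ⟨y, rfl⟩ := F.toCluster_surjective S
    exact (h y (F.clusterRi_iff.1 hS)).resolve_left fun h' => h' hA

theorem preimage_relImp_clusterRm (hF : F.IsBHL) (A B : Set F.Cluster) :
    F.toCluster ⁻¹' relImp F.clusterRm A B =
      relBox F.Rm ((F.toCluster ⁻¹' A)ᶜ ∪ F.toCluster ⁻¹' B) := by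
  ext x
  constructor
  · intro h y hy
    by_cases hA : F.toCluster y ∈ A
    · exact Or.inr (h _ ((F.clusterRm_iff hF).2 ⟨y, rfl, hy⟩) hA)
    · exact Or.inl hA
  · intro h S hS hA
    obtain ⟨y, rfl⟩ := F.toCluster_surjective S
    obtain ⟨y', hy', hxy⟩ := (F.clusterRm_iff hF).1 hS
    rw [← hy'] at hA ⊢
    exact (h y' hxy).resolve_left fun h' => h' hA

theorem clusterRm_of_clusterRi_of_clusterRm (hF : F.IsBHL) (S T U : F.Cluster)
    (hST : F.clusterRi S T) (hTU : F.clusterRm T U) : F.clusterRm S U := by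
  obtain ⟨x, rfl⟩ := F.toCluster_surjective S
  obtain ⟨y, rfl⟩ := F.toCluster_surjective T
  obtain ⟨z, rfl⟩ := F.toCluster_surjective U
  rw [clusterRi_iff] at hST
  rw [F.clusterRm_iff hF] at *
  obtain ⟨z', hz, hyz⟩ := hTU
  exact ⟨z', hz, hF _ _ _ hST hyz⟩

/-- For a general S4BHL-frame, the general strict implication frame on its clusters. -/
def clusterFrame (hF : F.IsBHL) : GenStrictFrame F.Cluster where
  le := F.clusterRi
  sq := F.clusterRm
  isPartialOrder := F.isPartialOrder_clusterRi
  sq_of_le_of_sq := F.clusterRm_of_clusterRi_of_clusterRm hF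
  adm := F.rhoAdm
  upset_of_adm := fun _ ha => (F.mem_rhoAdm_iff.1 ha).1
  univ_adm := F.mem_rhoAdm_iff.2 ⟨fun _ _ _ _ => trivial, BooleanSubalgebra.top_mem⟩
  empty_adm := F.mem_rhoAdm_iff.2 ⟨fun _ _ h _ => h, BooleanSubalgebra.bot_mem⟩
  inter_adm := fun a ha b hb => by
    rw [mem_rhoAdm_iff] at *
    exact ⟨fun S T hS h => ⟨ha.1 S T hS.1 h, hb.1 S T hS.2 h⟩,
      BooleanSubalgebra.inf_mem ha.2 hb.2⟩
  union_adm := fun a ha b hb => by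
    rw [mem_rhoAdm_iff] at *
    exact ⟨fun S T hS h => hS.imp (ha.1 S T · h) (hb.1 S T · h),
      BooleanSubalgebra.sup_mem ha.2 hb.2⟩
  imp_adm := fun a ha b hb => by
    rw [mem_rhoAdm_iff] at *
    refine ⟨fun S T hS h U hU => hS U (F.isPartialOrder_clusterRi.trans _ _ _ h hU), ?_⟩
    rw [preimage_relImp_clusterRi]
    exact F.boxI_adm _ (BooleanSubalgebra.sup_mem (BooleanSubalgebra.compl_mem ha.2) hb.2)
  simp_adm := fun a ha b hb => by
    rw [mem_rhoAdm_iff] at *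
    refine ⟨fun S T hS h U hU => hS U (F.clusterRm_of_clusterRi_of_clusterRm hF _ _ _ h hU), ?_⟩
    rw [preimage_relImp_clusterRm F hF]
    exact F.boxM_adm _ (BooleanSubalgebra.sup_mem (BooleanSubalgebra.compl_mem ha.2) hb.2)

/-- The translation `ρ̂`: first replace `Rm` by `Rm* = Ri ∘ Rm`, then quotient by clusters. -/
def rhoHat : GenStrictFrame F.star.Cluster :=
  F.star.clusterFrame F.star_isBHL

end GenS4KFrame

/-! ### Finite intersections and compactness -/

/-! For `rhoHat`, everything rests on separating closed sets by compactness. Tightness says that the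
successors of a point form an intersection of a directed family of admissible sets. If this misses
another such intersection, two single members are already disjoint
(`Compact.exists_inter_eq_empty`). This is used twice: in `TightFor.comp`, to see that `Ri ∘ Rm` is
again tight, and in `exists_relUpset_of_forall_not_Rm`, where the second closed set is the cluster
of `y`, cut out by differences of admissible upsets; the separating difference `a \ b` gives strict
refinedness.

For `sigmaHat`, refinedness supplies the tightness witnesses directly. For compactness, a family
with the finite intersection property is extended to an ultrafilter, whose trace on generators and
their complements has a common point; agreement with that point spreads to the Boolean closure. -/

theorem exists_inter_subset_sInter {X : Type*} {D E : Set (Set X)} (hD : D.Nonempty)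
    (hE : E.Nonempty) (hDdir : ∀ s ∈ D, ∀ t ∈ D, ∃ u ∈ D, u ⊆ s ∩ t)
    (hEdir : ∀ s ∈ E, ∀ t ∈ E, ∃ u ∈ E, u ⊆ s ∩ t) {T : Set (Set X)} (hT : T.Finite)
    (hTsub : T ⊆ D ∪ E) : ∃ d ∈ D, ∃ e ∈ E, d ∩ e ⊆ ⋂₀ T := by
  induction T, hT using Set.Finite.induction_on with
  | empty =>
    obtain ⟨d, hd⟩ := hD
    obtain ⟨e, he⟩ := hE
    exact ⟨d, hd, e, he, by simp⟩
  | @insert a T _ _ ih =>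
    obtain ⟨d, hd, e, he, hde⟩ := ih fun t ht => hTsub (Set.mem_insert_of_mem _ ht)
    rw [Set.sInter_insert]
    rcases hTsub (Set.mem_insert a T) with ha | ha
    · obtain ⟨u, hu, hus⟩ := hDdir a ha d hd
      exact ⟨u, hu, e, he, fun x hx => ⟨(hus hx.1).1, hde ⟨(hus hx.1).2, hx.2⟩⟩⟩
    · obtain ⟨u, hu, hus⟩ := hEdir a ha e he
      exact ⟨d, hd, u, hu, fun x hx => ⟨(hus hx.2).1, hde ⟨hx.1, (hus hx.2).2⟩⟩⟩

/-- Elements of the Boolean subalgebra generated by `P` belong to an ultrafilter `U` exactly when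
they contain `x`, as soon as this holds for the elements of `P`. -/
theorem mem_ultrafilter_iff_of_mem_closure {X : Type*} {P : Set (Set X)} {U : Ultrafilter X} {x : X}
    (h : ∀ a ∈ P, a ∈ U ↔ x ∈ a) {c : Set X} (hc : c ∈ BooleanSubalgebra.closure P) :
    c ∈ U ↔ x ∈ c := by
  induction hc using BooleanSubalgebra.closure_bot_sup_induction with
  | mem a ha => exact h a ha
  | bot => exact iff_of_false U.empty_notMem id
  | sup a _ b _ iha ihb => exact Ultrafilter.union_mem_iff.trans (or_congr iha ihb)
  | compl a _ iha => exact Ultrafilter.compl_mem_iff_notMem.trans (not_congr iha)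

namespace GenS4KFrame

variable {X : Type*} {F : GenS4KFrame X}

/-- Otherwise all sets `d ∩ e` are nonempty, and by directedness these lie below all finite
intersections from `D ∪ E`, so compactness yields a common point. -/
theorem Compact.exists_inter_eq_empty (hF : F.Compact) {D E : Set (Set X)}
    (hDadm : D ⊆ (F.adm : Set (Set X))) (hEadm : E ⊆ (F.adm : Set (Set X)))
    (hD : D.Nonempty) (hE : E.Nonempty) (hDdir : ∀ s ∈ D, ∀ t ∈ D, ∃ u ∈ D, u ⊆ s ∩ t)
    (hEdir : ∀ s ∈ E, ∀ t ∈ E, ∃ u ∈ E, u ⊆ s ∩ t)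
    (h : ∀ x, ¬ ((∀ d ∈ D, x ∈ d) ∧ ∀ e ∈ E, x ∈ e)) : ∃ d ∈ D, ∃ e ∈ E, d ∩ e = ∅ := by
  by_contra! hne
  obtain ⟨x, hx⟩ := hF (D ∪ E) (Set.union_subset hDadm hEadm) fun T hTsub hT => by
    obtain ⟨d, hd, e, he, hde⟩ := exists_inter_subset_sInter hD hE hDdir hEdir hT hTsub
    exact (hne d hd e he).mono hde
  exact h x ⟨fun d hd => hx d (Or.inl hd), fun e he => hx e (Or.inr he)⟩

/-! ### Tightness and relational composition -/

/-- The admissible sets containing all `R`-successors of a point. -/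
def boxNhds (F : GenS4KFrame X) (R : X → X → Prop) (x : X) : Set (Set X) :=
  {d | d ∈ F.adm ∧ x ∈ relBox R d}

theorem boxNhds_nonempty (R : X → X → Prop) (x : X) : (F.boxNhds R x).Nonempty :=
  ⟨Set.univ, BooleanSubalgebra.top_mem, fun _ _ => trivial⟩

theorem boxNhds_directed (R : X → X → Prop) (x : X) :
    ∀ s ∈ F.boxNhds R x, ∀ t ∈ F.boxNhds R x, ∃ u ∈ F.boxNhds R x, u ⊆ s ∩ t :=
  fun s hs t ht => ⟨s ∩ t, ⟨BooleanSubalgebra.inf_mem hs.1 ht.1,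
    fun y hy => ⟨hs.2 y hy, ht.2 y hy⟩⟩, subset_rfl⟩

theorem TightFor.iff_forall_boxNhds {R : X → X → Prop} (hR : F.TightFor R) {x y : X} :
    R x y ↔ ∀ d ∈ F.boxNhds R x, y ∈ d :=
  (hR x y).trans ⟨fun h d hd => h d hd.1 hd.2, fun h d hd hx => h d ⟨hd, hx⟩⟩

theorem tightFor_iff {R : X → X → Prop} :
    F.TightFor R ↔ ∀ x y, ¬ R x y → ∃ a ∈ F.adm, x ∈ relBox R a ∧ y ∉ a := by
  refine ⟨fun h x y hxy => ?_, fun h x y => ⟨fun hxy a _ hx => hx y hxy, fun hxy => ?_⟩⟩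
  · simpa [h x y] using hxy
  · by_contra hn
    obtain ⟨a, ha, hx, hy⟩ := h x y hn
    exact hy (hxy a ha hx)

/-- In a compact frame, tightness is preserved under relational composition. -/
theorem TightFor.comp {R S : X → X → Prop} (hF : F.Compact) (hR : F.TightFor R)
    (hS : F.TightFor S) (hbox : ∀ a ∈ F.adm, relBox S a ∈ F.adm) :
    F.TightFor (Relation.Comp R S) := by
  refine tightFor_iff.2 fun x z hxz => ?_
  -- By tightness of `S`, the `S`-predecessors of `z` are the points outside every `relBox S d` with
  -- `z ∉ d`. Disjointness then means `e ⊆ relBox S d`, so `d` is the witness.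
  obtain ⟨e, he, _, ⟨d, ⟨hd, hzd⟩, rfl⟩, hed⟩ := hF.exists_inter_eq_empty
    (D := F.boxNhds R x) (E := (fun d => (relBox S d)ᶜ) '' {d | d ∈ F.adm ∧ z ∉ d})
    (fun _ hd => hd.1)
    (by rintro _ ⟨d, hd, rfl⟩; exact BooleanSubalgebra.compl_mem (hbox d hd.1))
    (boxNhds_nonempty R x) ⟨_, ∅, ⟨BooleanSubalgebra.bot_mem, id⟩, rfl⟩ (boxNhds_directed R x)
    (by
      rintro _ ⟨d, hd, rfl⟩ _ ⟨d', hd', rfl⟩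
      exact ⟨_, ⟨d ∪ d', ⟨BooleanSubalgebra.sup_mem hd.1 hd'.1, not_or.2 ⟨hd.2, hd'.2⟩⟩, rfl⟩,
        fun y hy => ⟨fun h => hy fun w hw => Or.inl (h w hw),
          fun h => hy fun w hw => Or.inr (h w hw)⟩⟩)
    (fun y ⟨hy, hy'⟩ => hxz ⟨y, hR.iff_forall_boxNhds.2 hy, hS.iff_forall_boxNhds.2
      fun d hd => by_contra fun hz => hy' _ ⟨d, ⟨hd.1, hz⟩, rfl⟩ hd.2⟩)
  refine ⟨d, hd, fun w ⟨y, hxy, hyw⟩ => ?_, hzd⟩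
  by_contra hw
  exact hed.subset ⟨he.2 y hxy, fun h => hw (h w hyw)⟩

theorem Descriptive.star (hF : F.Descriptive) : F.star.Descriptive where
  differentiated := hF.differentiated
  tightI := hF.tightI
  tightM := TightFor.comp hF.compact hF.tightI hF.tightM F.boxM_adm
  compact := hF.compact

/-! ### The frame of clusters -/

theorem preimage_image_toCluster {a : Set X} (ha : RelUpset F.Ri a) :
    F.toCluster ⁻¹' (F.toCluster '' a) = a := by
  refine subset_antisymm ?_ (Set.subset_preimage_image _ _)
  rintro x ⟨y, hy, hyx⟩
  exact ha y x hy (F.toCluster_eq_iff.1 hyx).1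

theorem image_toCluster_mem_rhoAdm {a : Set X} (ha : RelUpset F.Ri a) (hadm : a ∈ F.adm) :
    F.toCluster '' a ∈ F.rhoAdm := by
  rw [mem_rhoAdm_iff, preimage_image_toCluster ha]
  refine ⟨?_, hadm⟩
  rintro _ T ⟨x, hx, rfl⟩ hT
  obtain ⟨y, rfl⟩ := F.toCluster_surjective T
  exact ⟨y, ha x y hx (F.clusterRi_iff.1 hT), rfl⟩

theorem relUpset_relBox_Ri (a : Set X) : RelUpset F.Ri (relBox F.Ri a) :=
  fun _ _ hx hxy z hyz => hx z (F.isPreorder.trans _ _ _ hxy hyz)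

theorem relBox_Ri_subset (a : Set X) : relBox F.Ri a ⊆ a :=
  fun x hx => hx x (F.isPreorder.refl x)

/-- The box of a tightness witness still separates, and transitivity makes it an upset. -/
theorem exists_relUpset_of_not_Ri (hF : F.Descriptive) {x y : X} (h : ¬ F.Ri x y) :
    ∃ a ∈ F.adm, RelUpset F.Ri a ∧ x ∈ a ∧ y ∉ a := by
  obtain ⟨a, ha, hx, hy⟩ := tightFor_iff.1 hF.tightI x y h
  exact ⟨_, F.boxI_adm a ha, relUpset_relBox_Ri a, hx, fun h => hy (relBox_Ri_subset a h)⟩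

/-- A closed set of successors missing the cluster of `y` is separated from `y` by a difference
of admissible upsets. -/
theorem exists_relUpset_of_forall_not_Rm (hF : F.Descriptive) {x y : X}
    (h : ∀ y', F.toCluster y' = F.toCluster y → ¬ F.Rm x y') :
    ∃ a ∈ F.adm, ∃ b ∈ F.adm, RelUpset F.Ri a ∧ RelUpset F.Ri b ∧
      x ∈ relImp F.Rm a b ∧ y ∈ a ∧ y ∉ b := by
  -- The differences containing `y` intersect in exactly the cluster of `y`: those of the forms
  -- `univ \ a` and `a \ ∅` already force `y' Ri y` and `y Ri y'`.
  obtain ⟨d, hd, _, ⟨a, b, ha, hb, hua, hub, hya, hyb, rfl⟩, hde⟩ :=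
    hF.compact.exists_inter_eq_empty (D := F.boxNhds F.Rm x)
      (E := {c | ∃ a b, a ∈ F.adm ∧ b ∈ F.adm ∧ RelUpset F.Ri a ∧ RelUpset F.Ri b ∧
        y ∈ a ∧ y ∉ b ∧ c = a \ b})
      (fun _ hd => hd.1)
      (by
        rintro _ ⟨a, b, ha, hb, -, -, -, -, rfl⟩
        exact BooleanSubalgebra.sdiff_mem ha hb)
      (boxNhds_nonempty F.Rm x)
      ⟨_, Set.univ, ∅, BooleanSubalgebra.top_mem, BooleanSubalgebra.bot_mem,
        fun _ _ _ _ => trivial, fun _ _ h _ => h, trivial, id, rfl⟩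
      (boxNhds_directed F.Rm x)
      (by
        rintro _ ⟨a, b, ha, hb, hua, hub, hya, hyb, rfl⟩
          _ ⟨a', b', ha', hb', hua', hub', hya', hyb', rfl⟩
        exact ⟨_, ⟨a ∩ a', b ∪ b', BooleanSubalgebra.inf_mem ha ha',
          BooleanSubalgebra.sup_mem hb hb',
          fun u v hu huv => ⟨hua u v hu.1 huv, hua' u v hu.2 huv⟩,
          fun u v hu huv => hu.imp (hub u v · huv) (hub' u v · huv),
          ⟨hya, hya'⟩, not_or.2 ⟨hyb, hyb'⟩, rfl⟩,
          fun u hu => ⟨⟨hu.1.1, fun h => hu.2 (Or.inl h)⟩, hu.1.2, fun h => hu.2 (Or.inr h)⟩⟩)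
      (by
        rintro y' ⟨hy', hyy'⟩
        refine h y' (F.toCluster_eq_iff.2 ⟨?_, ?_⟩) (hF.tightM.iff_forall_boxNhds.2 hy')
        · by_contra hn
          obtain ⟨a, ha, hua, hya, hya'⟩ := exists_relUpset_of_not_Ri hF hn
          exact (hyy' _ ⟨Set.univ, a, BooleanSubalgebra.top_mem, ha, fun _ _ _ _ => trivial, hua,
            trivial, hya', rfl⟩).2 hya
        · by_contra hn
          obtain ⟨a, ha, hua, hya, hya'⟩ := exists_relUpset_of_not_Ri hF hn
          exact hya' (hyy' _ ⟨a, ∅, ha, BooleanSubalgebra.bot_mem, hua, fun _ _ h _ => h, hya, id,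
            rfl⟩).1)
  refine ⟨a, ha, b, hb, hua, hub, fun z hxz hza => ?_, hya, hyb⟩
  by_contra hzb
  exact hde.subset ⟨hd.2 z hxz, hza, hzb⟩

/-- Preimages under `toCluster` are admissible, and surjectivity carries the finite intersection
property to them. -/
theorem compact_clusterFrame (hF : F.Compact) (hBHL : F.IsBHL) :
    (F.clusterFrame hBHL).Compact := by
  intro A B hA hB hAB
  obtain ⟨x, hx⟩ := hF (Set.preimage F.toCluster '' (A ∪ B))
    (by
      rintro _ ⟨a, ha | ha, rfl⟩
      · exact (F.mem_rhoAdm_iff.1 (hA ha)).2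
      · obtain ⟨b, hb, rfl⟩ := hB ha
        exact BooleanSubalgebra.compl_mem (F.mem_rhoAdm_iff.1 hb).2)
    (by
      intro T hTsub hT
      obtain ⟨T', hT'sub, hT', rfl⟩ := Set.exists_subset_image_finite_and.1 ⟨T, hTsub, hT, rfl⟩
      obtain ⟨S, hS⟩ := hAB T' hT'sub hT'
      obtain ⟨x, rfl⟩ := F.toCluster_surjective S
      exact ⟨x, by rintro _ ⟨a, ha, rfl⟩; exact hS a ha⟩)
  exact ⟨F.toCluster x, fun a ha => hx _ ⟨a, ha, rfl⟩⟩

theorem leRefined_clusterFrame (hF : F.Descriptive) (hBHL : F.IsBHL) :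
    (F.clusterFrame hBHL).LeRefined := by
  intro S T hST
  obtain ⟨x, rfl⟩ := F.toCluster_surjective S
  obtain ⟨y, rfl⟩ := F.toCluster_surjective T
  obtain ⟨a, ha, hua, hx, hy⟩ :=
    exists_relUpset_of_not_Ri hF fun h => hST (F.clusterRi_iff.2 h)
  refine ⟨_, image_toCluster_mem_rhoAdm hua ha, Set.mem_image_of_mem _ hx, ?_⟩
  rwa [← Set.mem_preimage, preimage_image_toCluster hua]

theorem sqRefined_clusterFrame (hF : F.Descriptive) (hBHL : F.IsBHL) :
    (F.clusterFrame hBHL).SqRefined := by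
  intro S T hST
  obtain ⟨x, rfl⟩ := F.toCluster_surjective S
  obtain ⟨y, rfl⟩ := F.toCluster_surjective T
  obtain ⟨a, ha, b, hb, hua, hub, hx, hya, hyb⟩ := exists_relUpset_of_forall_not_Rm hF
    fun y' hy' h => hST ((F.clusterRm_iff hBHL).2 ⟨y', hy', h⟩)
  refine ⟨_, image_toCluster_mem_rhoAdm hua ha, _, image_toCluster_mem_rhoAdm hub hb, ?_,
    Set.mem_image_of_mem _ hya, ?_⟩
  · intro U hU hUa
    obtain ⟨z, rfl, hxz⟩ : ∃ z, F.toCluster z = U ∧ F.Rm x z := by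
      obtain ⟨z, rfl⟩ := F.toCluster_surjective U
      exact (F.clusterRm_iff hBHL).1 hU
    rw [← Set.mem_preimage, preimage_image_toCluster hua] at hUa
    exact Set.mem_image_of_mem _ (hx z hxz hUa)
  · rwa [← Set.mem_preimage, preimage_image_toCluster hub]

theorem Descriptive.clusterFrame (hF : F.Descriptive) (hBHL : F.IsBHL) :
    (F.clusterFrame hBHL).Descriptive where
  compact := compact_clusterFrame hF.compact hBHL
  leRefined := leRefined_clusterFrame hF hBHL
  sqRefined := sqRefined_clusterFrame hF hBHL

end GenS4KFrame

/-! ### The Boolean closure of a descriptive frame -/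

namespace GenStrictFrame

variable {X : Type*} {G : GenStrictFrame X}

theorem Compact.sigmaHat (hG : G.Compact) : G.sigmaHat.Compact := by
  intro A hA hfip
  have : (Filter.generate A).NeBot := Filter.generate_neBot_iff.2 hfip
  set U := Ultrafilter.of (Filter.generate A)
  -- Compactness of `G` only concerns generators and their complements, so it is applied to those
  -- lying in `U`.
  obtain ⟨x, hx⟩ := hG {a | a ∈ G.adm ∧ a ∈ U} {c | ∃ a ∈ G.adm, c = aᶜ ∧ c ∈ U}
    (fun _ ha => ha.1) (fun c ⟨a, ha, hc, _⟩ => ⟨a, ha, hc⟩)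
    (fun T hTsub hT => U.nonempty_of_mem ((Filter.sInter_mem hT).2 fun t ht => by
      rcases hTsub ht with h | ⟨_, _, _, h⟩
      exacts [h.2, h]))
  have hU : ∀ a ∈ G.adm, a ∈ U ↔ x ∈ a := fun a ha => by
    refine ⟨fun h => hx a (Or.inl ⟨ha, h⟩), fun h => ?_⟩
    by_contra hn
    exact hx aᶜ (Or.inr ⟨a, ha, rfl, Ultrafilter.compl_mem_iff_notMem.2 hn⟩) h
  exact ⟨x, fun c hc => (mem_ultrafilter_iff_of_mem_closure hU (hA hc)).1
    (Ultrafilter.of_le _ (Filter.mem_generate_of_mem hc))⟩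

theorem Descriptive.sigmaHat (hG : G.Descriptive) : G.sigmaHat.Descriptive where
  differentiated x y := by
    refine ⟨fun h a _ => by rw [h], fun h => ?_⟩
    have hle : ∀ {u v : X}, (∀ a ∈ G.adm, u ∈ a → v ∈ a) → G.le u v := fun huv => by
      by_contra hn
      obtain ⟨a, ha, hu, hv⟩ := hG.leRefined _ _ hn
      exact hv (huv a ha hu)
    exact G.isPartialOrder.antisymm x y
      (hle fun a ha => (h a (BooleanSubalgebra.subset_closure ha)).1)
      (hle fun a ha => (h a (BooleanSubalgebra.subset_closure ha)).2)
  tightI := GenS4KFrame.tightFor_iff.2 fun x y hxy => by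
    obtain ⟨a, ha, hx, hy⟩ := hG.leRefined x y hxy
    exact ⟨a, BooleanSubalgebra.subset_closure ha, fun z hz => G.upset_of_adm a ha x z hx hz, hy⟩
  tightM := GenS4KFrame.tightFor_iff.2 fun x y hxy => by
    obtain ⟨a, ha, b, hb, hx, hya, hyb⟩ := hG.sqRefined x y hxy
    -- Strict implication from `a` to `b` is the box of `aᶜ ∪ b`.
    refine ⟨aᶜ ∪ b, BooleanSubalgebra.sup_mem
      (BooleanSubalgebra.compl_mem (BooleanSubalgebra.subset_closure ha))
      (BooleanSubalgebra.subset_closure hb), fun z hz => ?_, not_or.2 ⟨not_not.2 hya, hyb⟩⟩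
    by_cases hza : z ∈ a
    exacts [Or.inr (hx z hz hza), Or.inl hza]
  compact := hG.compact.sigmaHat

end GenStrictFrame

theorem mainTheorem9 :
    (∀ {X : Type*} (F : GenS4KFrame X), F.Descriptive → F.rhoHat.Descriptive) ∧
      (∀ {X : Type*} (G : GenStrictFrame X), G.Descriptive → G.sigmaHat.Descriptive) :=
  ⟨fun F hF => hF.star.clusterFrame F.star_isBHL, fun _ hG => hG.sigmaHat⟩
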